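/- **Conventions.** A tree is a partial order in which the predecessors of each node $t$ are well-ordered; their order type is the height $\mathrm{ht}(t)$, $T_\alpha$ is the set of nodes of height $\alpha$, the height of $T$ is the least $\alpha$ with $T_\alpha=\emptyset$, $\mathrm{NF}(t)$ is the set of immediate successors of $t$, and $T(t)=\{s\in T: t\le s\}$. A tree is normal if it has a single minimal node (the root), each node $s$ with $\mathrm{ht}(s)+1<\mathrm{ht}(T)$ has at least two immediate successors, each node has successors in every higher non-empty level, and nodes of limit height with the same set of predecessors are equal. A Souslin tree is a tree of height $\omega_1$ all of whose antichains (sets of pairwise incomparable nodes) and branches (downward closed chains) are countable; here Souslin trees are moreover normal and $\aleph_0$-splitting (each non-maximal node has exactly $\aleph_0$ immediate successors). A tree is rigid if its only automorphism is the identity. The tree product $\bigotimes_{i\in I}S_i$ consists of the tuples $(x_i)_{i\in I}$ of nodes $x_i\in S_i$ of a common height, with $x<y$ iff $x_i<y_i$ for all $i$. A Souslin tree $T$ is strongly homogeneous if it has a coherent family, i.e. a family of isomorphisms $\psi_{st}:T(s)\to T(t)$, for $\mathrm{ht}(s)=\mathrm{ht}(t)$, such that: $\psi_{ss}=\mathrm{id}$;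 $\psi_{rt}=\psi_{st}\circ\psi_{rs}$; if $t\ge r$ and $u=\psi_{rs}(t)$, then $\psi_{tu}=\psi_{rs}\upharpoonright T(t)$; and if $t,u$ are nodes of the same limit height, there are $r<t$, $s<u$ of the same height with $\psi_{rs}(t)=u$. An $n$-optimal matrix of partitions is a family of partitions $P_{k,m}=\{a^{k,m}_i: i\in\omega\}$ ($k\in\omega$, $m<n$) of $\omega$ into infinitely many non-empty sets (indexed without repetition) such that (i) for all $m<n$, $k\in\omega$ and $i:k\to\omega$ the set $\bigcap_{\ell<k}a^{\ell,m}_{i(\ell)}$ is infinite; (ii) whenever $(k(j),m(j))$, $j<n$, are pairwise distinct and $m$ is not constant, then $\bigcap_{j<n}a^{k(j),m(j)}_{i(j)}$ is a singleton for every $i:n\to\omega$. **The decomposition procedure.** Let $n>1$, let $T$ be a strongly homogeneous Souslin tree with coherent family $(\psi_{st})$, and let $(P_{k,m})$ be an $n$-optimal matrix of partitions. For each $\alpha<\omega_1$ choose a node $r_\alpha\in T_\alpha$ and a bijection $\sigma_\alpha:\omega\to\mathrm{NF}(r_\alpha)$, and for $s\in T_\alpha$ put $a^{k,m}_i(s)=(\psi_{r_\alpha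 s}\circ\sigma_\alpha)''a^{k,m}_i$. For each $m<n$ define, by recursion on levels, an equivalence relation $\equiv_m$ on $T$ that relates only nodes of the same height, together with a map $h_m:T\to\omega$ such that for $s,t$ of the same height $h_m(s)=h_m(t)$ iff $s\equiv_m t$ (any such $h_m$ with $h_m(\mathrm{root})=0$ is allowed): * if $s,t$ are of the same successor height, with direct predecessors $s^-,t^-$, then $s\equiv_m t$ iff $s^-\equiv_m t^-$ and there is $i\in\omega$ with $s\in a_i^{h_m(s^-),m}(s^-)$ and $t\in a_i^{h_m(t^-),m}(t^-)$; * if $s,t$ are of the same limit height, then $s\equiv_m t$ iff $q\equiv_m r$ for all $q<s$, $r<t$ of equal height. Let $S_m=T/{\equiv_m}$ be the set of $\equiv_m$-classes, where one class is below another iff some representative of the first is below some representative of the second. **Proposition.** Let $T$ be a strongly homogeneous Souslin tree, let $n>1$, and let $S_0,\dots,S_{n-1}$ be obtained from $T$ by this procedure, for any choices made in it. Then for every non-empty $I\subseteq\{0,\dots,n-1\}$ with $|I|<n$, the tree product $\bigotimes_{m\in I}S_m$ is a rigid Souslin tree. -/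

import Mathlib

universe u v

namespace Souslin

/-- A tree: a partial order in which the predecessors of every node are well-ordered. -/
class IsTree (T : Type u) [PartialOrder T] : Prop where
  isWellOrder_Iio : ∀ t : T, IsWellOrder (Set.Iio t) (· < ·)

attribute [instance] IsTree.isWellOrder_Iio

section Tree

variable {T : Type u} [PartialOrder T] [IsTree T]

/-- The height of a node: the order type of the set of its predecessors. -/
noncomputable def ht (t : T) : Ordinal.{u} :=
  Ordinal.type (α := Set.Iio t) (· < ·)

/-- The height of `s < t` is the position of `s` among the predecessors of `t`. -/
theorem ht_eq_typein {s t : T} (h : s < t) :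
    ht s = Ordinal.typein (α := Set.Iio t) (· < ·) ⟨s, h⟩ := by
  rw [← Ordinal.type_subrel (α := Set.Iio t) (· < ·) ⟨s, h⟩]
  refine Ordinal.type_eq.2 ⟨⟨⟨fun x => ⟨⟨x.1, lt_trans x.2 h⟩, x.2⟩, fun x => ⟨x.1.1, x.2⟩,
    fun _ => rfl, fun _ => rfl⟩, Iff.rfl⟩⟩

theorem ht_lt_ht {s t : T} (h : s < t) : ht s < ht t := by
  rw [ht_eq_typein h]
  exact Ordinal.typein_lt_type _ _

/-- A node has predecessors in every lower level. -/
theorem exists_lt_ht_eq {t : T} {α : Ordinal.{u}} (h : α < ht t) : ∃ s, s < t ∧ ht s = α := by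
  obtain ⟨x, hx⟩ := Ordinal.typein_surj (α := Set.Iio t) (· < ·) h
  exact ⟨x.1, x.2, (ht_eq_typein x.2).trans hx⟩

/-- Two nodes below a common node are comparable, and their heights decide how. -/
theorem le_of_ht_le {r s t : T} (hr : r ≤ t) (hs : s ≤ t) (h : ht r ≤ ht s) : r ≤ s := by
  rcases hs.eq_or_lt with rfl | hs
  · exact hr
  rcases hr.eq_or_lt with rfl | hr
  · exact absurd h (not_le_of_gt (ht_lt_ht hs))
  rcases trichotomous_of (α := Set.Iio t) (· < ·) ⟨r, hr⟩ ⟨s, hs⟩ with h1 | h1 | h1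
  · exact le_of_lt h1
  · exact le_of_eq (congrArg Subtype.val h1)
  · exact absurd h (not_le_of_gt (ht_lt_ht (show s < r from h1)))

theorem eq_of_ht_eq {r s t : T} (hr : r ≤ t) (hs : s ≤ t) (h : ht r = ht s) : r = s :=
  le_antisymm (le_of_ht_le hr hs h.le) (le_of_ht_le hs hr h.ge)

end Tree

/-- The height of a tree: the least ordinal `α` such that the level `α` is empty. -/
noncomputable def treeHeight (T : Type u) [PartialOrder T] [IsTree T] : Ordinal.{u} :=
  sInf {α | ∀ t : T, ht t ≠ α}

/-- Normal trees. The immediate successors of a node `s` are the nodes `u` with `s ⋖ u`. -/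
structure IsNormal (T : Type u) [PartialOrder T] [IsTree T] : Prop where
  /-- there is a single minimal node, the root -/
  root : ∃! r : T, IsMin r
  /-- each node of height `α` with `α + 1` below the height of the tree has at least two
  immediate successors -/
  splits : ∀ s : T, ht s + 1 < treeHeight T → ∃ t u : T, s ⋖ t ∧ s ⋖ u ∧ t ≠ u
  /-- each node has successors in every higher non-empty level -/
  extends_up : ∀ (s : T) (α : Ordinal.{u}), ht s < α → (∃ t : T, ht t = α) →
    ∃ t : T, s < t ∧ ht t = α
  /-- branches of limit length have at most one limit -/
  limit_unique : ∀ s t : T, Order.IsSuccLimit (ht s) → Order.IsSuccLimit (ht t) →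
    Set.Iio s = Set.Iio t → s = t

/-- Every node except for the leaves has exactly `ℵ₀` immediate successors. -/
def IsAlephZeroSplitting (T : Type u) [PartialOrder T] : Prop :=
  ∀ s : T, ¬ IsMax s → Cardinal.mk {u : T // s ⋖ u} = Cardinal.aleph0

/-- Souslin trees (always normal and `ℵ₀`-splitting): trees of height `ω₁` all of whose
antichains and branches are countable. -/
structure IsSouslinTree (T : Type u) [PartialOrder T] : Prop extends IsTree T where
  normal : IsNormal T
  splitting : IsAlephZeroSplitting T
  height : treeHeight T = Ordinal.omega 1
  antichain_countable : ∀ A : Set T, IsAntichain (· ≤ ·) A → A.Countable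
  branch_countable : ∀ b : Set T, IsChain (· ≤ ·) b → IsLowerSet b → b.Countable

/-- A tree is rigid if the identity is its only automorphism. -/
def IsRigid (T : Type u) [PartialOrder T] : Prop :=
  ∀ φ : T ≃o T, φ = OrderIso.refl T

/-- A coherent family of isomorphisms `ψ s t` between the trees `T(s)` and `T(t)` of nodes above
(and including) `s` and `t`, for all nodes `s`, `t` of the same height. -/
structure CoherentFamily (T : Type u) [PartialOrder T] [IsTree T] where
  ψ : ∀ s t : T, ht s = ht t → (Set.Ici s ≃o Set.Ici t)
  refl : ∀ s : T, ψ s s rfl = OrderIso.refl (Set.Ici s)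
  /-- commutativity -/
  comm : ∀ (r s t : T) (hrs : ht r = ht s) (hst : ht s = ht t) (x : Set.Ici r),
    ψ r t (hrs.trans hst) x = ψ s t hst (ψ r s hrs x)
  /-- coherence: if `t` is above `r` and `u = ψ r s t`, then `ψ t u` is the restriction of `ψ r s`
  to `T(t)` -/
  coherence : ∀ (r s t u : T) (hrs : ht r = ht s) (hrt : r ≤ t) (htu : ht t = ht u),
    (ψ r s hrs ⟨t, hrt⟩ : T) = u →
      ∀ (x : T) (hx : t ≤ x), (ψ t u htu ⟨x, hx⟩ : T) = ψ r s hrs ⟨x, hrt.trans hx⟩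
  /-- transitivity: for `t`, `u` on the same limit level there are predecessors `r`, `s` of `t`, `u`
  on one lower level with `ψ r s t = u` -/
  transitivity : ∀ t u : T, ht t = ht u → Order.IsSuccLimit (ht t) →
    ∃ (r s : T) (hr : r < t) (_ : s < u) (hrs : ht r = ht s),
      (ψ r s hrs ⟨t, hr.le⟩ : T) = u

/-- A Souslin tree is strongly homogeneous if it carries a coherent family. -/
def IsStronglyHomogeneous (T : Type u) [PartialOrder T] [IsTree T] : Prop :=
  Nonempty (CoherentFamily T)

/-- An `n`-optimal matrix of partitions: for every row `k` and column `m < n`, the sets `a k m i`,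
`i ∈ ω`, form an infinite partition of `ω`. -/
structure IsOptimalMatrix (n : ℕ) (a : ℕ → Fin n → ℕ → Set ℕ) : Prop where
  nonempty : ∀ k m i, (a k m i).Nonempty
  disjoint : ∀ k m, Pairwise fun i j => Disjoint (a k m i) (a k m j)
  cover : ∀ k m, ⋃ i, a k m i = Set.univ
  /-- column-wise agreement -/
  agreement : ∀ (m : Fin n) (k : ℕ) (i : Fin k → ℕ), (⋂ l : Fin k, a l m (i l)).Infinite
  /-- `n`-optimality -/
  optimal : ∀ (i k : Fin n → ℕ) (m : Fin n → Fin n),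
    (∀ j l, j < l → (k j, m j) ≠ (k l, m l)) → (∃ j l, m j ≠ m l) →
      ∃ x, ⋂ j, a (k j) (m j) (i j) = {x}

/-- A tree equivalence relation: it respects levels and is compatible with the tree order. -/
structure TreeEquivalence (T : Type u) [PartialOrder T] [IsTree T] extends Setoid T where
  ht_eq : ∀ {s t : T}, toSetoid s t → ht s = ht t
  compat : ∀ {s r t u : T}, ht s = ht r → s < t → toSetoid t u → r < u → toSetoid s r

namespace TreeEquivalence

variable {T : Type u} [PartialOrder T] [IsTree T] (E : TreeEquivalence T)

/-- The quotient tree `T/≡`. -/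
def Quot : Type u := Quotient E.toSetoid

theorem compat_le {s r t u : T} (h : ht s = ht r) (hst : s ≤ t) (htu : E.toSetoid t u)
    (hru : r ≤ u) : E.toSetoid s r := by
  have h1 := E.ht_eq htu
  rcases hst.eq_or_lt with rfl | hst
  · rcases hru.eq_or_lt with rfl | hru
    · exact htu
    · exact absurd (ht_lt_ht hru) (by rw [← h, h1]; exact lt_irrefl _)
  · rcases hru.eq_or_lt with rfl | hru
    · exact absurd (ht_lt_ht hst) (by rw [h, h1]; exact lt_irrefl _)
    · exact E.compat h hst htu hru

/-- If `t ≡ u` and `s ≤ t`, there is `r ≤ u` with `s ≡ r`. -/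
theorem exists_le {s t u : T} (hst : s ≤ t) (htu : E.toSetoid t u) :
    ∃ r, r ≤ u ∧ E.toSetoid s r := by
  have h1 := E.ht_eq htu
  rcases hst.eq_or_lt with rfl | hst
  · exact ⟨u, le_rfl, htu⟩
  · obtain ⟨r, hr, hr'⟩ := exists_lt_ht_eq (h1 ▸ ht_lt_ht hst)
    exact ⟨r, hr.le, E.compat hr'.symm hst htu hr⟩

/-- The inherited order: a class is below another one if some representatives are. -/
instance : PartialOrder E.Quot where
  le a b := ∃ s t : T, Quotient.mk E.toSetoid s = a ∧ Quotient.mk E.toSetoid t = b ∧ s ≤ t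
  le_refl a := by
    obtain ⟨s, rfl⟩ := Quotient.exists_rep a
    exact ⟨s, s, rfl, rfl, le_rfl⟩
  le_trans a b c := by
    rintro ⟨s, t, rfl, rfl, hst⟩ ⟨t', u, h, rfl, htu⟩
    obtain ⟨r, hr, hsr⟩ := E.exists_le hst (Quotient.exact h.symm)
    exact ⟨r, u, (Quotient.sound hsr).symm, rfl, hr.trans htu⟩
  le_antisymm a b := by
    rintro ⟨s, t, rfl, rfl, hst⟩ ⟨t', s', h1, h2, hts⟩
    have e1 := E.ht_eq (Quotient.exact h1)
    have e2 := E.ht_eq (Quotient.exact h2)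
    rcases hst.eq_or_lt with rfl | hst
    · rfl
    · have h3 := ht_lt_ht hst
      rcases hts.eq_or_lt with rfl | hts
      · exact absurd h3 (by rw [← e1, ← e2]; exact lt_irrefl _)
      · have h4 := ht_lt_ht hts
        rw [e1, e2] at h4
        exact absurd h3 h4.asymm

theorem lt_iff (a b : E.Quot) :
    a < b ↔ ∃ s t : T, Quotient.mk E.toSetoid s = a ∧ Quotient.mk E.toSetoid t = b ∧ s < t := by
  constructor
  · intro h
    obtain ⟨s, t, rfl, rfl, hst⟩ := h.le
    refine ⟨s, t, rfl, rfl, lt_of_le_of_ne hst ?_⟩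
    rintro rfl
    exact lt_irrefl _ h
  · rintro ⟨s, t, rfl, rfl, hst⟩
    refine lt_of_le_of_ne ⟨s, t, rfl, rfl, hst.le⟩ fun h => ?_
    exact absurd (ht_lt_ht hst) (by rw [E.ht_eq (Quotient.exact h)]; exact lt_irrefl _)

instance : IsTree E.Quot where
  isWellOrder_Iio c := by
    let f : E.Quot → Ordinal.{u} := Quotient.lift ht fun _ _ h => E.ht_eq h
    have hf : ∀ a b : E.Quot, a < b → f a < f b := by
      intro a b h
      obtain ⟨s, t, rfl, rfl, hst⟩ := (E.lt_iff a b).1 h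
      exact ht_lt_ht hst
    have key : ∀ a b : E.Quot, a < c → b < c → f a ≤ f b → a ≤ b := by
      intro a b ha hb hab
      obtain ⟨s, t, rfl, rfl, hst⟩ := (E.lt_iff a c).1 ha
      obtain ⟨s', t', rfl, h, hst'⟩ := (E.lt_iff b _).1 hb
      obtain ⟨r, hr, hsr⟩ := E.exists_le hst'.le (Quotient.exact h)
      refine ⟨s, r, rfl, (Quotient.sound hsr).symm, le_of_ht_le hst.le hr ?_⟩
      rw [← E.ht_eq hsr]
      exact hab
    refine { wf := ?_, trichotomous := ?_ }
    · exact Subrelation.wf (fun {a b} h => hf a.1 b.1 h)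
        (InvImage.wf (fun a : Set.Iio c => f a.1) Ordinal.lt_wf)
    · intro a b h1 h2
      refine Subtype.ext ?_
      rcases le_total (f a.1) (f b.1) with h | h
      · have := key a.1 b.1 a.2 b.2 h
        exact this.eq_or_lt.resolve_right h1
      · have := key b.1 a.1 b.2 a.2 h
        exact (this.eq_or_lt.resolve_right h2).symm

end TreeEquivalence

/-- The tree product: tuples of nodes of a common height, one from each factor. -/
def TreeProd {ι : Type v} (S : ι → Type u) [∀ i, PartialOrder (S i)] [∀ i, IsTree (S i)] :
    Type (max u v) :=
  {x : ∀ i, S i // ∀ i j, ht (x i) = ht (x j)}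

namespace TreeProd

variable {ι : Type v} (S : ι → Type u) [∀ i, PartialOrder (S i)] [∀ i, IsTree (S i)]

/-- The order of the product is the conjunction of the orders of the factors. -/
instance : PartialOrder (TreeProd S) :=
  inferInstanceAs (PartialOrder {x : ∀ i, S i // ∀ i j, ht (x i) = ht (x j)})

theorem lt_iff [Nonempty ι] (x y : TreeProd S) : x < y ↔ ∀ i, x.1 i < y.1 i := by
  constructor
  · intro h i
    have hle : ∀ j, x.1 j ≤ y.1 j := h.le
    refine lt_of_le_of_ne (hle i) fun e => h.ne (Subtype.ext (funext fun j => ?_))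
    refine (hle j).eq_or_lt.resolve_right fun hj => ?_
    have := ht_lt_ht hj
    rw [x.2 j i, y.2 j i, e] at this
    exact lt_irrefl _ this
  · intro h
    have hle : x ≤ y := fun i => (h i).le
    refine lt_of_le_of_ne hle ?_
    rintro rfl
    exact lt_irrefl _ (h (Classical.arbitrary ι))

end TreeProd

/-- All choices made, and the tree equivalence relations `≡_m`, `m < n`, obtained, when a strongly
homogeneous tree `T` is decomposed by means of an `n`-optimal matrix of partitions. -/
structure Decomposition (T : Type u) [PartialOrder T] [IsTree T] (n : ℕ) where
  /-- the coherent family of `T` -/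
  fam : CoherentFamily T
  /-- the matrix; `a k m i` is the `i`-th set of the partition in row `k` and column `m` -/
  a : ℕ → Fin n → ℕ → Set ℕ
  optimal : IsOptimalMatrix n a
  /-- the anchor node of every (non-empty) level -/
  anchor : Ordinal.{u} → T
  ht_anchor : ∀ s : T, ht (anchor (ht s)) = ht s
  /-- an enumeration of the immediate successors of the anchor node -/
  σ : ∀ α : Ordinal.{u}, ℕ ≃ {u : T // anchor α ⋖ u}
  /-- the relations `≡_m` -/
  eqv : Fin n → Setoid T
  /-- the enumerations of the `≡_m`-classes of each level -/
  h : Fin n → T → ℕ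
  /-- `≡_m` respects levels -/
  eqv_ht : ∀ (m : Fin n) (s t : T), eqv m s t → ht s = ht t
  h_root : ∀ (m : Fin n) (r : T), IsMin r → h m r = 0
  h_eq_iff : ∀ (m : Fin n) (s t : T), ht s = ht t → (h m s = h m t ↔ eqv m s t)
  /-- successor levels: nodes `s`, `t` with direct predecessors `s'`, `t'` are equivalent iff `s'`
  and `t'` are and `s`, `t` lie in sets of the same index `i` of the copies, on the immediate
  successors of `s'` and of `t'`, of the partition in column `m` and row `h m s' = h m t'` -/
  eqv_succ : ∀ (m : Fin n) (s' t' s t : T), s' ⋖ s → t' ⋖ t →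
    (eqv m s t ↔ eqv m s' t' ∧ ∃ i : ℕ,
      s ∈ (fun x : ℕ => (fam.ψ (anchor (ht s')) s' (ht_anchor s')
        ⟨(σ (ht s') x).1, (σ (ht s') x).2.le⟩ : T)) '' a (h m s') m i ∧
      t ∈ (fun x : ℕ => (fam.ψ (anchor (ht t')) t' (ht_anchor t')
        ⟨(σ (ht t') x).1, (σ (ht t') x).2.le⟩ : T)) '' a (h m t') m i)
  /-- limit levels: nodes are equivalent iff all their predecessors of equal height are -/
  eqv_limit : ∀ (m : Fin n) (s t : T), ht s = ht t → Order.IsSuccLimit (ht s) →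
    (eqv m s t ↔ ∀ q r : T, q < s → r < t → ht q = ht r → eqv m q r)

namespace Decomposition

variable {T : Type u} [PartialOrder T] [IsTree T] {n : ℕ} (D : Decomposition T n)

theorem eqv_compat (m : Fin n) (t : T) : ∀ {s r u : T}, ht s = ht r → s < t → D.eqv m t u →
    r < u → D.eqv m s r := by
  induction hα : ht t using WellFoundedLT.induction generalizing t with
  | ind α ih =>
    intro s r u hsr hst htu hru
    have htu' := D.eqv_ht m t u htu
    rcases Ordinal.zero_or_succ_or_isSuccLimit (ht t) with h0 | ⟨γ, hγ⟩ | hl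
    · exact absurd (ht_lt_ht hst) (by rw [h0]; exact not_lt_zero)
    · have cov : ∀ x : T, ht x = Order.succ γ → ∃ x', x' ⋖ x ∧ ht x' = γ := by
        intro x hx
        obtain ⟨x', h1, h2⟩ := exists_lt_ht_eq (t := x) (hx ▸ Order.lt_succ γ)
        refine ⟨x', ⟨h1, fun y hy hy' => ?_⟩, h2⟩
        have e1 := ht_lt_ht hy
        have e2 := ht_lt_ht hy'
        rw [hx] at e2
        rw [h2] at e1
        exact absurd e1 (not_lt_of_ge (Order.lt_succ_iff.1 e2))
      have hγ1 : ht t = Order.succ γ := by rw [← hγ]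
      obtain ⟨t', ht1, ht2⟩ := cov t hγ1
      obtain ⟨u', hu1, hu2⟩ := cov u (htu' ▸ hγ1)
      have h' := ((D.eqv_succ m t' u' t u ht1 hu1).1 htu).1
      have hs : ht s ≤ ht t' := by
        rw [ht2]; exact Order.lt_succ_iff.1 (hγ1 ▸ ht_lt_ht hst)
      have hs' : s ≤ t' := le_of_ht_le hst.le ht1.le hs
      have hr' : r ≤ u' := le_of_ht_le hru.le hu1.le (by rw [← hsr, hu2, ← ht2]; exact hs)
      rcases hs'.eq_or_lt with rfl | hs'
      · have : r = u' := eq_of_ht_eq hru.le hu1.le (by rw [← hsr, hu2, ht2])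
        rw [this]; exact h'
      · rcases hr'.eq_or_lt with rfl | hr'
        · exact absurd (ht_lt_ht hs') (by rw [hsr, hu2, ht2]; exact lt_irrefl _)
        · exact ih (ht t') (hα ▸ ht_lt_ht ht1.lt) t' rfl hsr hs' h' hr'
    · exact (D.eqv_limit m t u htu' hl).1 htu s r hst hru hsr

/-- `≡_m` as a tree equivalence relation. -/
def rel (m : Fin n) : TreeEquivalence T where
  toSetoid := D.eqv m
  ht_eq := D.eqv_ht m _ _
  compat := D.eqv_compat m _

/-- The `m`-th factor `S_m = T/≡_m` of the decomposition. -/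
abbrev Factor (m : Fin n) : Type u := (D.rel m).Quot

end Decomposition

end Souslin

/-! Send a node of `T` to the tuple of its classes in the columns of `I`. This map `proj` is
monotone and height preserving, and it is onto because the matrix allows at most `n` cells from
different partitions to be met at once (`exists_eqv_of_isSouslinTree`). A section of `proj` lifts
antichains to antichains, so the product inherits the Souslin property from `T`.

For rigidity, lift an automorphism `φ` of the product to a function `g` on `T`. If no isomorphism of
the coherent family induced `φ` above any node beyond `s₀`, then each `ψ` from `r` to `g r` would
fail on a dense upward closed set, hence everywhere above some countable level. At a level closed
under these bounds, transitivity of the family contradicts this (`exists_orderIso_eq_map`). So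
densely often `φ` is given by some `ψ` from `r` to `s`.

Such a `ψ` preserves the numbering of immediate successors. If `r` and `s` were inequivalent in a
column of `I`, then, as `|I| < n` leaves room for one more cell, two successors of `r` with the same
projection would go to successors of `s` with different ones (`proj_eq_of_map`). Hence `φ` fixes the
projection of `r` and everything below it. -/

namespace Souslin

/-! ### Heights, automorphisms and branches in trees -/

section Tree

variable {T : Type u} [PartialOrder T] [IsTree T]

theorem ht_le_ht {s t : T} (h : s ≤ t) : ht s ≤ ht t := by
  rcases h.eq_or_lt with rfl | h
  · exact le_rfl
  · exact (ht_lt_ht h).le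

theorem lt_of_ht_lt {r s t : T} (hr : r ≤ t) (hs : s ≤ t) (h : ht r < ht s) : r < s :=
  lt_of_le_of_ne (le_of_ht_le hr hs h.le) (by rintro rfl; exact lt_irrefl _ h)

theorem exists_le_ht_eq {t : T} {α : Ordinal.{u}} (h : α ≤ ht t) : ∃ s, s ≤ t ∧ ht s = α := by
  rcases h.eq_or_lt with rfl | h
  · exact ⟨t, le_rfl, rfl⟩
  · obtain ⟨s, hs, h⟩ := exists_lt_ht_eq h
    exact ⟨s, hs.le, h⟩

theorem isMin_iff_ht_eq_zero {t : T} : IsMin t ↔ ht t = 0 := by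
  constructor
  · intro h
    by_contra h0
    obtain ⟨s, hs, -⟩ := exists_lt_ht_eq (pos_iff_ne_zero.2 h0)
    exact h.not_lt hs
  · intro h
    rw [isMin_iff_forall_not_lt]
    intro s hs
    have := ht_lt_ht hs
    rw [h] at this
    exact not_lt_zero this

theorem covBy_iff_ht {s t : T} : s ⋖ t ↔ s < t ∧ ht t = Order.succ (ht s) := by
  constructor
  · intro h
    refine ⟨h.lt, ?_⟩
    by_contra hne
    have hlt := lt_of_le_of_ne (Order.succ_le_of_lt (ht_lt_ht h.lt)) (Ne.symm hne)
    obtain ⟨y, hy, hy'⟩ := exists_lt_ht_eq hlt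
    exact h.2 (lt_of_ht_lt h.lt.le hy.le (hy' ▸ Order.lt_succ _)) hy
  · rintro ⟨h, h'⟩
    refine ⟨h, fun y hy hy' => ?_⟩
    have h2 := ht_lt_ht hy'
    rw [h', Order.lt_succ_iff] at h2
    exact absurd (ht_lt_ht hy) (not_lt_of_ge h2)

/-- A strictly monotone rank without gaps is the height. -/
theorem ht_eq_of_rank (f : T → Ordinal.{u}) (hf : ∀ s t, s < t → f s < f t)
    (hf' : ∀ t, ∀ α < f t, ∃ s < t, f s = α) (t : T) : ht t = f t := by
  induction hα : f t using WellFoundedLT.induction generalizing t with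
  | ind α ih =>
    subst hα
    refine le_antisymm (not_lt.1 fun h => ?_) (not_lt.1 fun h => ?_)
    · obtain ⟨s, hs, hs'⟩ := exists_lt_ht_eq h
      have := ih (f s) (hf _ _ hs) s rfl
      rw [hs'] at this
      exact (hf _ _ hs).ne this.symm
    · obtain ⟨s, hs, hs'⟩ := hf' t _ h
      have := ih (f s) (hf _ _ hs) s rfl
      rw [hs'] at this
      exact (ht_lt_ht hs).ne this

theorem ht_orderIso (φ : T ≃o T) (t : T) : ht (φ t) = ht t := by
  refine (ht_eq_of_rank (fun t => ht (φ t)) (fun s t h => ht_lt_ht (φ.lt_iff_lt.2 h)) ?_ t).symm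
  intro t α h
  obtain ⟨s, hs, h'⟩ := exists_lt_ht_eq h
  refine ⟨φ.symm s, ?_, by simpa using h'⟩
  rw [← φ.lt_iff_lt]
  simpa using hs

theorem isAntichain_ht_eq (α : Ordinal.{u}) : IsAntichain (· ≤ ·) {t : T | ht t = α} := by
  intro s hs t ht' hne hle
  exact (ht_lt_ht (lt_of_le_of_ne hle hne)).ne (hs.trans ht'.symm)

theorem isAntichain_covBy (s : T) : IsAntichain (· ≤ ·) {t : T | s ⋖ t} :=
  (isAntichain_ht_eq (Order.succ (ht s))).subset fun _ h => (covBy_iff_ht.1 h).2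

/-- In a tree with countable antichains in which every node has two immediate successors, all
branches are countable. -/
theorem countable_of_isChain_of_splits
    (hA : ∀ A : Set T, IsAntichain (· ≤ ·) A → A.Countable)
    (hS : ∀ s : T, ∃ t u : T, s ⋖ t ∧ s ⋖ u ∧ t ≠ u)
    (b : Set T) (hb : IsChain (· ≤ ·) b) (hl : IsLowerSet b) : b.Countable := by
  have key : ∀ s : T, ∃ t, s ⋖ t ∧ t ∉ b := by
    intro s
    obtain ⟨t, u, h1, h2, hne⟩ := hS s
    by_contra! h
    rcases hb (h t h1) (h u h2) hne with h3 | h3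
    · exact isAntichain_covBy s h1 h2 hne h3
    · exact isAntichain_covBy s h2 h1 hne.symm h3
  choose f hf hf' using key
  -- The successors leaving the chain are pairwise incomparable: if `x < y` and `f x ≤ f y`, then
  -- already `f x ≤ y`, which puts `f x` into `b`.
  have hinc : ∀ x ∈ b, ∀ y ∈ b, x ≠ y → ¬ f x ≤ f y := by
    intro x hx y hy hne hle
    rcases hb hx hy hne with h | h
    · have hlt := lt_of_le_of_ne h hne
      refine hf' x (hl (a := y) (b := f x) ?_ hy)
      refine le_of_ht_le hle (hf y).le ?_
      rw [(covBy_iff_ht.1 (hf x)).2]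
      exact Order.succ_le_of_lt (ht_lt_ht hlt)
    · have hlt := ht_lt_ht (lt_of_le_of_ne h hne.symm)
      have h3 := ht_le_ht hle
      rw [(covBy_iff_ht.1 (hf x)).2, (covBy_iff_ht.1 (hf y)).2, Order.succ_le_succ_iff] at h3
      exact absurd hlt (not_lt_of_ge h3)
  refine Set.countable_of_injective_of_countable_image (f := f) ?_ (hA (f '' b) ?_)
  · intro x hx y hy hxy
    by_contra hne
    exact hinc x hx y hy hne hxy.le
  · rintro _ ⟨x, hx, rfl⟩ _ ⟨y, hy, rfl⟩ hne
    exact hinc x hx y hy (fun h => hne (h ▸ rfl))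

end Tree

/-! ### Countable levels and closure points of Souslin trees -/

section Height

variable {T : Type u} [PartialOrder T] [IsTree T]

theorem IsSouslinTree.exists_ht_eq (hT : IsSouslinTree T) {α : Ordinal.{u}}
    (h : α < Ordinal.omega 1) : ∃ t : T, ht t = α := by
  rw [← hT.height] at h
  by_contra! h'
  exact absurd h (not_lt_of_ge (csInf_le' h'))

theorem IsSouslinTree.ht_lt (hT : IsSouslinTree T) (t : T) : ht t < Ordinal.omega 1 := by
  have hmem : Ordinal.omega.{u} 1 ∈ {α : Ordinal.{u} | ∀ t : T, ht t ≠ α} := by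
    rw [← hT.height]
    -- The infimum of the empty set is `0`, so height `ω₁` shows that some level, and hence level
    -- `ω₁`, really is empty.
    refine csInf_mem (Set.nonempty_iff_ne_empty.2 fun he => ?_)
    have := hT.height
    rw [treeHeight, he, Ordinal.sInf_empty] at this
    exact (Ordinal.omega_pos 1).ne this
  by_contra h
  obtain ⟨s, -, hs⟩ := exists_le_ht_eq (not_lt.1 h)
  exact hmem s hs

theorem IsSouslinTree.exists_gt (hT : IsSouslinTree T) (s : T) {α : Ordinal.{u}}
    (h : α < Ordinal.omega 1) (hs : ht s < α) : ∃ t : T, s < t ∧ ht t = α :=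
  hT.normal.extends_up s α hs (hT.exists_ht_eq h)

theorem exists_bound_lt_omega_one {A : Set Ordinal.{u}} (hA : A.Countable)
    (h : ∀ α ∈ A, α < Ordinal.omega.{u} 1) : ∃ β < Ordinal.omega.{u} 1, ∀ α ∈ A, α < β := by
  have := hA.to_subtype
  refine ⟨⨆ α : A, Order.succ α.1, Ordinal.iSup_lt_omega_one fun α =>
    (Cardinal.isSuccLimit_omega 1).succ_lt (h _ α.2), fun α hα => ?_⟩
  refine (Order.lt_succ α).trans_le (le_ciSup (f := fun α : A => Order.succ α.1) ?_ ⟨α, hα⟩)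
  exact ⟨Ordinal.omega 1, by
    rintro _ ⟨α, rfl⟩
    exact ((Cardinal.isSuccLimit_omega 1).succ_lt (h _ α.2)).le⟩

theorem countable_Iio_of_lt_omega_one {α : Ordinal.{u}} (h : α < Ordinal.omega.{u} 1) :
    (Set.Iio α).Countable := by
  rw [Cardinal.lt_omega_iff_card_lt, Cardinal.lt_aleph_one_iff] at h
  rw [← Cardinal.le_aleph0_iff_set_countable, Cardinal.mk_Iio_ordinal]
  exact Cardinal.lift_le_aleph0.2 h

theorem IsSouslinTree.countable_ht_lt (hT : IsSouslinTree T) {α : Ordinal.{u}}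
    (h : α < Ordinal.omega.{u} 1) : {t : T | ht t < α}.Countable := by
  have : {t : T | ht t < α} = ⋃ β ∈ Set.Iio α, {t : T | ht t = β} := by
    ext t; simp
  rw [this]
  exact (countable_Iio_of_lt_omega_one h).biUnion fun β _ =>
    hT.antichain_countable _ (isAntichain_ht_eq β)

/-- An upward closed set that is dense above a node contains all nodes above it from some countable
level on. -/
theorem IsSouslinTree.exists_level_subset (hT : IsSouslinTree T) (s : T) (U : Set T)
    (hU : IsUpperSet U) (hd : ∀ t, s ≤ t → ∃ x, t ≤ x ∧ x ∈ U) :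
    ∃ β < Ordinal.omega.{u} 1, ∀ x, s ≤ x → β ≤ ht x → x ∈ U := by
  -- The minimal elements of `U` above `s` form an antichain, so their heights are bounded by a
  -- countable `β`. A node of height at least `β` has an extension in `U`, and the minimal element
  -- below that extension already lies below the node.
  set A : Set T := {x | s ≤ x ∧ x ∈ U ∧ ∀ y, y < x → s ≤ y → y ∉ U} with hAdef
  have hA : IsAntichain (· ≤ ·) A := by
    intro x hx y hy hne hle
    exact hy.2.2 x (lt_of_le_of_ne hle hne) hx.1 hx.2.1
  obtain ⟨β, hβ, hAβ⟩ := exists_bound_lt_omega_one ((hT.antichain_countable A hA).image ht)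
    (by rintro _ ⟨x, -, rfl⟩; exact hT.ht_lt x)
  refine ⟨β, hβ, fun x hx hxβ => ?_⟩
  obtain ⟨y, hxy, hyU⟩ := hd x hx
  obtain ⟨z, ⟨hz1, hz2, hz3⟩, hz⟩ := (InvImage.wf (ht (T := T)) Ordinal.lt_wf).has_min
    {z | s ≤ z ∧ z ≤ y ∧ z ∈ U} ⟨y, hx.trans hxy, le_rfl, hyU⟩
  have hzA : z ∈ A := ⟨hz1, hz3, fun w hw hsw hwU =>
    hz w ⟨hsw, hw.le.trans hz2, hwU⟩ (ht_lt_ht hw)⟩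
  have : ht z ≤ ht x := (hAβ _ ⟨z, hzA, rfl⟩).le.trans hxβ
  exact hU (le_of_ht_le hz2 hxy this) hz3

/-- Every function from the nodes to the countable ordinals has a countable limit closure point
above any given countable ordinal. -/
theorem IsSouslinTree.exists_closed_limit (hT : IsSouslinTree T) (f : T → Ordinal.{u})
    (hf : ∀ t, f t < Ordinal.omega.{u} 1) (α : Ordinal.{u}) (hα : α < Ordinal.omega.{u} 1) :
    ∃ δ < Ordinal.omega.{u} 1, Order.IsSuccLimit δ ∧ α < δ ∧ ∀ t, ht t < δ → f t < δ := by
  have step : ∀ γ : Ordinal.{u}, ∃ γ', γ < Ordinal.omega.{u} 1 → γ' < Ordinal.omega.{u} 1 ∧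
      γ < γ' ∧ ∀ t, ht t < γ → f t < γ' := by
    intro γ
    by_cases hγ : γ < Ordinal.omega.{u} 1
    · obtain ⟨β, hβ, h⟩ := exists_bound_lt_omega_one
        (((hT.countable_ht_lt hγ).image f).insert γ) (by
          rintro _ (rfl | ⟨x, -, rfl⟩)
          · exact hγ
          · exact hf x)
      exact ⟨β, fun _ => ⟨hβ, h γ (Set.mem_insert _ _),
        fun t ht' => h _ (Set.mem_insert_of_mem _ ⟨t, ht', rfl⟩)⟩⟩
    · exact ⟨0, fun h => absurd h hγ⟩
  choose g hg using step
  -- The closure point is the supremum of the strictly increasing `ω`-sequence of iterates, hence a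
  -- limit.
  let c : ℕ → Ordinal.{u} := fun k => g^[k] α
  have hc : ∀ k, c k < Ordinal.omega.{u} 1 := by
    intro k
    induction k with
    | zero => exact hα
    | succ k ih =>
      simp only [c, Function.iterate_succ_apply']
      exact (hg _ ih).1
  have hcs : ∀ k, c (k + 1) = g (c k) := fun k => Function.iterate_succ_apply' _ _ _
  obtain ⟨β, hβ, hcβ⟩ := exists_bound_lt_omega_one (Set.countable_range c)
    (by rintro _ ⟨k, rfl⟩; exact hc k)
  have hbdd : BddAbove (Set.range c) := ⟨β, by rintro _ ⟨k, rfl⟩; exact (hcβ _ ⟨k, rfl⟩).le⟩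
  have hlt : ∀ k, c k < ⨆ k, c k := fun k => by
    refine lt_of_lt_of_le ?_ (le_ciSup hbdd (k + 1))
    rw [hcs]
    exact (hg _ (hc k)).2.1
  have hex : ∀ γ < ⨆ k, c k, ∃ k, γ < c k := fun γ h => exists_lt_of_lt_ciSup h
  refine ⟨⨆ k, c k, (ciSup_le fun k => (hcβ _ ⟨k, rfl⟩).le).trans_lt hβ, ?_, hlt 0, ?_⟩
  · refine ⟨?_, ?_⟩
    · rw [isMin_iff_forall_not_lt]
      exact fun h => h _ (hlt 0)
    · intro γ hγ
      obtain ⟨k, hk⟩ := hex γ hγ.lt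
      exact hγ.2 hk (hlt k)
  · intro t ht'
    obtain ⟨k, hk⟩ := hex _ ht'
    exact ((hg _ (hc k)).2.2 t hk).trans (hcs k ▸ hlt (k + 1))

end Height

end Souslin

namespace Souslin

/-! ### Heights in products and quotients -/

namespace TreeProd

variable {ι : Type v} (S : ι → Type u) [∀ i, PartialOrder (S i)] [∀ i, IsTree (S i)]

variable {S}

/-- A node of the product has predecessors of every height below the common height of its
components. -/
theorem exists_lt_of_lt_ht [Nonempty ι] (x : TreeProd S) (i : ι) {α : Ordinal.{u}}
    (h : α < ht (x.1 i)) : ∃ y : TreeProd S, y < x ∧ ∀ j, ht (y.1 j) = α := by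
  have key : ∀ j, ∃ s, s < x.1 j ∧ ht s = α := fun j => exists_lt_ht_eq (x.2 i j ▸ h)
  choose f hf hf' using key
  exact ⟨⟨f, fun j k => (hf' j).trans (hf' k).symm⟩, (lt_iff S _ _).2 hf, hf'⟩

end TreeProd

instance TreeProd.instIsTree {ι : Type v} [Nonempty ι] (S : ι → Type u)
    [∀ i, PartialOrder (S i)] [∀ i, IsTree (S i)] : IsTree (TreeProd S) where
  isWellOrder_Iio c := by
    let i₀ : ι := Classical.arbitrary ι
    have key : ∀ a b : TreeProd S, a < c → b < c → ht (a.1 i₀) ≤ ht (b.1 i₀) → a ≤ b := by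
      intro a b ha hb hab i
      refine le_of_ht_le (ha.le i) (hb.le i) ?_
      rwa [a.2 i i₀, b.2 i i₀]
    refine { wf := ?_, trichotomous := ?_ }
    · exact Subrelation.wf (fun {a b} h => ht_lt_ht ((TreeProd.lt_iff S a.1 b.1).1 h i₀))
        (InvImage.wf (fun a : Set.Iio c => ht (a.1.1 i₀)) Ordinal.lt_wf)
    · intro a b h1 h2
      refine Subtype.ext ?_
      rcases le_total (ht (a.1.1 i₀)) (ht (b.1.1 i₀)) with h | h
      · exact (key a.1 b.1 a.2 b.2 h).eq_or_lt.resolve_right h1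
      · exact ((key b.1 a.1 b.2 a.2 h).eq_or_lt.resolve_right h2).symm

theorem TreeEquivalence.ht_mk {T : Type u} [PartialOrder T] [IsTree T] (E : TreeEquivalence T)
    (t : T) : ht (T := E.Quot) (Quotient.mk E.toSetoid t) = ht t := by
  refine ht_eq_of_rank (T := E.Quot) (Quotient.lift ht fun _ _ h => E.ht_eq h) ?_ ?_ _
  · intro a b h
    obtain ⟨s, t, rfl, rfl, hst⟩ := (E.lt_iff a b).1 h
    exact ht_lt_ht hst
  · intro b α h
    obtain ⟨t, rfl⟩ := Quotient.exists_rep b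
    obtain ⟨s, hs, hs'⟩ := exists_lt_ht_eq (t := t) h
    exact ⟨Quotient.mk E.toSetoid s, (E.lt_iff _ _).2 ⟨s, t, rfl, rfl, hs⟩, hs'⟩

/-! ### Souslin trees under height preserving surjections -/

section Transfer

variable {T S : Type u} [PartialOrder T] [IsTree T] [PartialOrder S] [IsTree S]

/-- The image of a Souslin tree under a height preserving order homomorphism is Souslin, if it is
`ℵ₀`-splitting and branches of limit length have unique limits. -/
theorem IsSouslinTree.of_surjective (hT : IsSouslinTree T) (π : T → S)
    (hπ : Function.Surjective π) (hmono : Monotone π) (hht : ∀ t, ht (π t) = ht t)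
    (hinf : ∀ x : S, {y | x ⋖ y}.Infinite)
    (hlim : ∀ s t : S, Order.IsSuccLimit (ht s) → Order.IsSuccLimit (ht t) →
      Set.Iio s = Set.Iio t → s = t) : IsSouslinTree S := by
  have hA : ∀ A : Set S, IsAntichain (· ≤ ·) A → A.Countable := by
    intro A hA
    have hinj : Function.Injective (Function.surjInv hπ) := Function.injective_surjInv hπ
    refine Set.countable_of_injective_of_countable_image (f := Function.surjInv hπ)
      hinj.injOn (hT.antichain_countable _ ?_)
    rintro _ ⟨x, hx, rfl⟩ _ ⟨y, hy, rfl⟩ hne hle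
    refine hA hx hy (fun h => hne (h ▸ rfl)) ?_
    have := hmono hle
    rwa [Function.surjInv_eq hπ, Function.surjInv_eq hπ] at this
  have hlevel : ∀ α : Ordinal.{u}, (∃ x : S, ht x = α) ↔ ∃ t : T, ht t = α := by
    intro α
    constructor
    · rintro ⟨x, rfl⟩
      obtain ⟨t, rfl⟩ := hπ x
      exact ⟨t, (hht t).symm⟩
    · rintro ⟨t, rfl⟩
      exact ⟨π t, hht t⟩
  have hsplit : ∀ s : S, ∃ t u : S, s ⋖ t ∧ s ⋖ u ∧ t ≠ u := by
    intro s
    obtain ⟨t, ht', u, hu, hne⟩ := (hinf s).nontrivial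
    exact ⟨t, u, ht', hu, hne⟩
  refine { toIsTree := inferInstance, normal := ?_, splitting := ?_, height := ?_,
           antichain_countable := hA,
           branch_countable := countable_of_isChain_of_splits hA hsplit }
  · refine ⟨?_, fun s _ => hsplit s, ?_, hlim⟩
    · obtain ⟨r, hr, hr'⟩ := hT.normal.root
      refine ⟨π r, ?_, ?_⟩
      · simp only
        rw [isMin_iff_ht_eq_zero, hht]
        exact isMin_iff_ht_eq_zero.1 hr
      · intro y hy
        obtain ⟨t, rfl⟩ := hπ y
        rw [isMin_iff_ht_eq_zero, hht, ← isMin_iff_ht_eq_zero] at hy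
        rw [hr' t hy]
    · intro x α hα hne
      obtain ⟨s, rfl⟩ := hπ x
      rw [hht] at hα
      obtain ⟨t, hst, rfl⟩ := hT.normal.extends_up s α hα ((hlevel α).1 hne)
      refine ⟨π t, lt_of_le_of_ne (hmono hst.le) fun h => ?_, hht t⟩
      have := congrArg ht h
      rw [hht, hht] at this
      exact hα.ne this
  · intro s _
    have h1 := hinf s
    have h2 := hA _ (isAntichain_covBy s)
    exact le_antisymm (Cardinal.le_aleph0_iff_set_countable.2 h2)
      (Cardinal.infinite_iff.1 h1.to_subtype)
  · rw [← hT.height, treeHeight, treeHeight]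
    congr 1
    ext α
    have := not_congr (hlevel α)
    push Not at this
    exact this

end Transfer

/-- Every choice of at most `n` sets from different partitions has a common element. -/
theorem IsOptimalMatrix.exists_mem {n : ℕ} {a : ℕ → Fin n → ℕ → Set ℕ} (h : IsOptimalMatrix n a)
    (hn : 0 < n) (F : Finset (ℕ × Fin n)) (hF : F.card ≤ n) (i : ℕ × Fin n → ℕ) :
    ∃ x, ∀ p ∈ F, x ∈ a p.1 p.2 (i p) := by
  -- With two columns present, `F` is padded to exactly `n` pairs and `n`-optimality applies. Within
  -- a single column it says nothing, and column-wise agreement on an initial segment of rows is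
  -- used.
  by_cases hc : ∃ p ∈ F, ∃ q ∈ F, p.2 ≠ q.2
  · obtain ⟨p, hp, q, hq, hpq⟩ := hc
    have : Nonempty (Fin n) := ⟨⟨0, hn⟩⟩
    obtain ⟨G, hFG, hG⟩ := Infinite.exists_superset_card_eq F n hF
    let e := (G.equivFinOfCardEq hG).symm
    obtain ⟨x, hx⟩ := h.optimal (fun j => i (e j)) (fun j => (e j).1.1) (fun j => (e j).1.2)
      (fun j l hjl heq => hjl.ne (e.injective (Subtype.ext heq)))
      ⟨e.symm ⟨p, hFG hp⟩, e.symm ⟨q, hFG hq⟩, by simpa using hpq⟩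
    refine ⟨x, fun r hr => ?_⟩
    have hx' : x ∈ ⋂ j, a (e j).1.1 (e j).1.2 (i (e j)) := hx ▸ rfl
    have := Set.mem_iInter.1 hx' (e.symm ⟨r, hFG hr⟩)
    simpa using this
  · push Not at hc
    rcases F.eq_empty_or_nonempty with rfl | ⟨p, hp⟩
    · exact ⟨0, by simp⟩
    obtain ⟨x, hx⟩ := (h.agreement p.2 (F.sup Prod.fst + 1) fun l => i (l, p.2)).nonempty
    refine ⟨x, fun q hq => ?_⟩
    have hlt : q.1 < F.sup Prod.fst + 1 :=
      Nat.lt_succ_of_le (Finset.le_sup (f := Prod.fst) hq)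
    have := Set.mem_iInter.1 hx ⟨q.1, hlt⟩
    rw [hc p hp q hq] at this
    exact this

/-! ### Calculus of coherent families -/

namespace CoherentFamily

variable {T : Type u} [PartialOrder T] [IsTree T] (F : CoherentFamily T)

/-- The value of the isomorphism from `T(s)` to `T(t)` at a node above `s`. -/
def map {s t : T} (h : ht s = ht t) {x : T} (hx : s ≤ x) : T := F.ψ s t h ⟨x, hx⟩

variable {F}

theorem le_map {s t : T} (h : ht s = ht t) {x : T} (hx : s ≤ x) : t ≤ F.map h hx :=
  (F.ψ s t h ⟨x, hx⟩).2

theorem map_le_map_iff {s t : T} (h : ht s = ht t) {x y : T} (hx : s ≤ x) (hy : s ≤ y) :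
    F.map h hx ≤ F.map h hy ↔ x ≤ y :=
  (F.ψ s t h).le_iff_le (x := ⟨x, hx⟩) (y := ⟨y, hy⟩)

theorem map_lt_map_iff {s t : T} (h : ht s = ht t) {x y : T} (hx : s ≤ x) (hy : s ≤ y) :
    F.map h hx < F.map h hy ↔ x < y :=
  (F.ψ s t h).lt_iff_lt (x := ⟨x, hx⟩) (y := ⟨y, hy⟩)

theorem map_rfl {s x : T} (hx : s ≤ x) : F.map rfl hx = x := by
  simp [map, F.refl]

theorem map_map {r s t : T} (hrs : ht r = ht s) (hst : ht s = ht t) {x : T} (hx : r ≤ x) :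
    F.map hst (le_map (F := F) hrs hx) = F.map (hrs.trans hst) hx :=
  congrArg Subtype.val (F.comm r s t hrs hst ⟨x, hx⟩).symm

theorem map_map_symm {s t : T} (h : ht s = ht t) {x : T} (hx : s ≤ x) :
    F.map h.symm (le_map (F := F) h hx) = x := by
  rw [map_map, map_rfl]

theorem map_coherent {r s t u : T} (hrs : ht r = ht s) (hrt : r ≤ t) (htu : ht t = ht u)
    (hu : F.map hrs hrt = u) {x : T} (hx : t ≤ x) : F.map htu hx = F.map hrs (hrt.trans hx) :=
  F.coherence r s t u hrs hrt htu hu x hx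

theorem map_self {s t : T} (h : ht s = ht t) : F.map h (le_refl s) = t := by
  refine le_antisymm ?_ (le_map h _)
  have h1 : F.map h.symm (le_refl t) ≥ s := le_map _ _
  have := (map_le_map_iff (F := F) h le_rfl h1).2 h1
  rwa [map_map_symm (F := F) h.symm] at this

theorem ht_le_ht_map {s t : T} (h : ht s = ht t) {x : T} (hx : s ≤ x) :
    ht x ≤ ht (F.map h hx) := by
  induction hα : ht x using WellFoundedLT.induction generalizing x with
  | ind α ih =>
    subst hα
    by_contra! hlt
    have h1 : ht s ≤ ht (F.map h hx) := h ▸ ht_le_ht (le_map h hx)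
    obtain ⟨y, hy, hy'⟩ := exists_lt_ht_eq hlt
    have hsy : s ≤ y := le_of_ht_le hx hy.le (hy'.symm ▸ h1)
    have h2 := ih _ (ht_lt_ht hy) hsy rfl
    have h3 := ht_lt_ht ((map_lt_map_iff (F := F) h hsy hx).2 hy)
    rw [← hy'] at h3
    exact absurd h3 (not_lt_of_ge h2)

theorem ht_map {s t : T} (h : ht s = ht t) {x : T} (hx : s ≤ x) : ht (F.map h hx) = ht x := by
  refine le_antisymm ?_ (ht_le_ht_map h hx)
  have := ht_le_ht_map (F := F) h.symm (le_map (F := F) h hx)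
  rwa [map_map_symm] at this

theorem covBy_map {s t : T} (h : ht s = ht t) {x : T} (hx : s ⋖ x) : t ⋖ F.map h hx.le := by
  have h1 := (map_lt_map_iff (F := F) h le_rfl hx.le).2 hx.lt
  rw [map_self] at h1
  rw [covBy_iff_ht, ht_map, (covBy_iff_ht.1 hx).2, h]
  exact ⟨h1, rfl⟩

/-- The isomorphism between predecessors of `t` and `u` maps `t` to `u` as soon as one between lower
predecessors does. -/
theorem map_eq_of_map_eq {r s r' s' t u : T} (hrs : ht r = ht s) (hrs' : ht r' = ht s')
    (hr : r ≤ r') (hr' : r' ≤ t) (hs' : s' ≤ u) (h : F.map hrs (hr.trans hr') = u) :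
    F.map hrs' hr' = u := by
  rw [← h]
  refine map_coherent hrs hr hrs' (eq_of_ht_eq (t := u) ?_ hs' ?_) hr'
  · rw [← h, map_le_map_iff]
    exact hr'
  · rw [ht_map, hrs']

end CoherentFamily

end Souslin

namespace Souslin

/-! ### Numbered immediate successors and the relations `≡_m` -/

namespace Decomposition

variable {T : Type u} [PartialOrder T] [IsTree T] {n : ℕ} (D : Decomposition T n)

/-- The `x`-th immediate successor of `s` in the enumeration copied from the anchor node. -/
noncomputable def succNode (s : T) (x : ℕ) : T :=
  D.fam.map (D.ht_anchor s) (D.σ (ht s) x).2.le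

theorem covBy_succNode (s : T) (x : ℕ) : s ⋖ D.succNode s x :=
  CoherentFamily.covBy_map _ (D.σ (ht s) x).2

theorem succNode_injective (s : T) : Function.Injective (D.succNode s) := by
  intro x y h
  have h1 := (D.fam.ψ _ s (D.ht_anchor s)).injective (Subtype.ext h)
  exact (D.σ (ht s)).injective (Subtype.ext (congrArg (fun z => z.1) h1))

theorem exists_succNode_eq {s u : T} (h : s ⋖ u) : ∃ x, D.succNode s x = u := by
  have hc := CoherentFamily.covBy_map (F := D.fam) (D.ht_anchor s).symm h
  obtain ⟨x, hx⟩ := (D.σ (ht s)).surjective ⟨_, hc⟩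
  refine ⟨x, ?_⟩
  have : D.succNode s x = D.fam.map (D.ht_anchor s) hc.le := by
    simp only [succNode, hx]
  rw [this]
  exact CoherentFamily.map_map_symm (D.ht_anchor s).symm h.le

/-- Both numberings are copied from the same anchor node, so commutativity of the family preserves
them. -/
theorem map_succNode {r s : T} (h : ht r = ht s) (x : ℕ) :
    D.fam.map h (D.covBy_succNode r x).le = D.succNode s x := by
  have key : ∀ (α : Ordinal.{u}) (h1 : ht (D.anchor α) = ht s) (h2 : α = ht s),
      D.fam.map h1 (D.σ α x).2.le = D.succNode s x := by
    rintro α h1 rfl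
    rfl
  exact (CoherentFamily.map_map (D.ht_anchor r) h (D.σ (ht r) x).2.le).trans (key _ _ h)

theorem eqv_succNode_iff (m : Fin n) (s t : T) (x y : ℕ) :
    D.eqv m (D.succNode s x) (D.succNode t y) ↔
      D.eqv m s t ∧ ∃ i, x ∈ D.a (D.h m s) m i ∧ y ∈ D.a (D.h m t) m i := by
  rw [D.eqv_succ m s t _ _ (D.covBy_succNode s x) (D.covBy_succNode t y)]
  refine and_congr_right fun _ => exists_congr fun i => and_congr ?_ ?_
  · exact (D.succNode_injective s).mem_set_image (a := x)
  · exact (D.succNode_injective t).mem_set_image (a := y)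

theorem h_eq {m : Fin n} {s t : T} (h : D.eqv m s t) : D.h m s = D.h m t :=
  (D.h_eq_iff m s t (D.eqv_ht m s t h)).2 h

theorem exists_mem_piece (k : ℕ) (m : Fin n) (x : ℕ) : ∃ i, x ∈ D.a k m i :=
  Set.mem_iUnion.1 (D.optimal.cover k m ▸ Set.mem_univ x)

theorem eq_of_mem_piece {k : ℕ} {m : Fin n} {x i j : ℕ} (hi : x ∈ D.a k m i)
    (hj : x ∈ D.a k m j) : i = j := by
  by_contra h
  exact Set.disjoint_left.1 (D.optimal.disjoint k m h) hi hj

/-- The isomorphism between equivalent nodes respects the equivalence relation. -/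
theorem eqv_map {m : Fin n} {r s : T} (hrs : D.eqv m r s) (h : ht r = ht s) {x : T}
    (hx : r ≤ x) : D.eqv m x (D.fam.map h hx) := by
  induction hα : ht x using WellFoundedLT.induction generalizing x with
  | ind α ih =>
    subst hα
    rcases hx.eq_or_lt with rfl | hlt
    · rwa [CoherentFamily.map_self]
    rcases Ordinal.zero_or_succ_or_isSuccLimit (ht x) with h0 | ⟨γ, hγ⟩ | hl
    · exact absurd (ht_lt_ht hlt) (by rw [h0]; exact not_lt_zero)
    · obtain ⟨y, hy, hy'⟩ := exists_lt_ht_eq (t := x) (α := γ) (hγ ▸ Order.lt_succ γ)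
      have hcov : y ⋖ x := covBy_iff_ht.2 ⟨hy, by rw [← hγ, hy']⟩
      have hry : r ≤ y := by
        refine le_of_ht_le hx hy.le ?_
        rw [hy', ← Order.lt_succ_iff]
        exact (ht_lt_ht hlt).trans_eq hγ.symm
      have hyx := ih _ (ht_lt_ht hy) hry rfl
      -- The image of the `k`-th successor is again a `k`-th successor, and equivalent predecessors
      -- use the same row, so both lie in the piece containing `k`.
      obtain ⟨k, rfl⟩ := D.exists_succNode_eq hcov
      have h1 : D.fam.map h hx = D.succNode (D.fam.map h hry) k := by
        rw [← D.map_succNode (CoherentFamily.ht_map h hry).symm k]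
        exact (CoherentFamily.map_coherent h hry _ rfl _).symm
      rw [h1, eqv_succNode_iff]
      obtain ⟨i, hi⟩ := D.exists_mem_piece (D.h m y) m k
      exact ⟨hyx, i, hi, D.h_eq hyx ▸ hi⟩
    · rw [D.eqv_limit m _ _ (CoherentFamily.ht_map h hx).symm hl]
      intro q q' hq hq' hqq'
      have key : ∀ p (hrp : r ≤ p), p < x → ∀ p', p' < D.fam.map h hx → ht p = ht p' →
          D.eqv m p p' := by
        intro p hrp hpx p' hp' hpp'
        have : D.fam.map h hrp = p' := by
          refine eq_of_ht_eq ((CoherentFamily.map_le_map_iff h hrp hx).2 hpx.le) hp'.le ?_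
          rw [CoherentFamily.ht_map, hpp']
        exact this ▸ ih _ (ht_lt_ht hpx) hrp rfl
      rcases le_total (ht r) (ht q) with hle | hle
      · exact key q (le_of_ht_le hx hq.le hle) hq q' hq' hqq'
      · have h1 : q ≤ r := le_of_ht_le hq.le hx hle
        have h2 : q' ≤ s := le_of_ht_le hq'.le (CoherentFamily.le_map h hx) (hqq' ▸ h ▸ hle)
        exact (D.rel m).compat_le hqq' h1 hrs h2

/-! ### The projection onto the product, and the Souslin property -/

variable (I : Finset (Fin n))

/-- The tuple of the classes of a node, for the columns in `I`. -/
def proj (t : T) : TreeProd fun m : I => D.Factor m :=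
  ⟨fun m => Quotient.mk (D.rel m).toSetoid t, fun i j => by
    rw [TreeEquivalence.ht_mk, TreeEquivalence.ht_mk]⟩

variable {I}

theorem proj_eq_iff {s t : T} : D.proj I s = D.proj I t ↔ ∀ m ∈ I, D.eqv m s t := by
  constructor
  · intro h m hm
    have := congrFun (congrArg Subtype.val h) ⟨m, hm⟩
    exact Quotient.exact this
  · intro h
    exact Subtype.ext (funext fun m => Quotient.sound (h m.1 m.2))

theorem proj_mono : Monotone (D.proj I) := fun s t h _ => ⟨s, t, rfl, rfl, h⟩

theorem ht_factor_eq_ht (hI : I.Nonempty) (x : TreeProd fun m : I => D.Factor m) (m : I) :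
    haveI := hI.to_subtype
    ht x = ht (x.1 m) := by
  have := hI.to_subtype
  refine ht_eq_of_rank (fun x : TreeProd fun m : I => D.Factor m => ht (x.1 m)) ?_ ?_ x
  · exact fun x y h => ht_lt_ht ((TreeProd.lt_iff _ _ _).1 h m)
  · intro x α h
    obtain ⟨y, hy, hy'⟩ := TreeProd.exists_lt_of_lt_ht x m h
    exact ⟨y, hy, hy' m⟩

theorem ht_proj [Nonempty I] (t : T) : ht (D.proj I t) = ht t := by
  obtain ⟨m⟩ := ‹Nonempty I›
  rw [D.ht_factor_eq_ht ⟨m.1, m.2⟩ _ m]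
  exact (D.rel m).ht_mk t

/-- Surjectivity of the projection, on representatives: the matrix handles successor levels,
transitivity of the coherent family handles limit levels. -/
theorem exists_eqv_of_isSouslinTree (hT : IsSouslinTree T) (hn : 0 < n) (hIn : I.card ≤ n)
    (hI : I.Nonempty) (α : Ordinal.{u}) (t : Fin n → T) (ht' : ∀ m ∈ I, ht (t m) = α) :
    ∃ q, ∀ m ∈ I, D.eqv m q (t m) := by
  induction α using WellFoundedLT.induction generalizing t with
  | ind α ih =>
    obtain ⟨m₁, hm₁⟩ := hI
    rcases Ordinal.zero_or_succ_or_isSuccLimit α with rfl | ⟨γ, rfl⟩ | hl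
    · refine ⟨t m₁, fun m hm => ?_⟩
      have : t m₁ = t m := hT.normal.root.unique (isMin_iff_ht_eq_zero.2 (ht' _ hm₁))
        (isMin_iff_ht_eq_zero.2 (ht' _ hm))
      exact this ▸ (D.eqv m).refl _
    · have key : ∀ m, ∃ s i x, m ∈ I → ht s = γ ∧ D.succNode s x = t m ∧
          x ∈ D.a (D.h m s) m i := by
        intro m
        by_cases hm : m ∈ I
        · obtain ⟨s, hs, hs'⟩ := exists_lt_ht_eq (t := t m) (α := γ)
            (by rw [ht' m hm]; exact Order.lt_succ γ)
          obtain ⟨x, hx⟩ := D.exists_succNode_eq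
            (covBy_iff_ht.2 ⟨hs, by rw [ht' m hm, hs']⟩)
          obtain ⟨i, hi⟩ := D.exists_mem_piece (D.h m s) m x
          exact ⟨s, i, x, fun _ => ⟨hs', hx, hi⟩⟩
        · exact ⟨t m, 0, 0, fun h => absurd h hm⟩
      choose s i x hsix using key
      obtain ⟨q, hq⟩ := ih γ (Order.lt_succ γ) s fun m hm => (hsix m hm).1
      -- One cell per column of `I`, in the row that `q` selects there; `y` numbers a successor of
      -- `q` meeting all of them.
      obtain ⟨y, hy⟩ := D.optimal.exists_mem hn (I.image fun m => (D.h m q, m))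
        (Finset.card_image_le.trans hIn) fun p => i p.2
      refine ⟨D.succNode q y, fun m hm => ?_⟩
      rw [← (hsix m hm).2.1, eqv_succNode_iff]
      exact ⟨hq m hm, i m, hy _ (Finset.mem_image_of_mem _ hm), (hsix m hm).2.2⟩
    · have key : ∀ m, ∃ r s : T, m ∈ I → ∃ (hr : r < t m₁) (_ : s < t m) (hrs : ht r = ht s),
          D.fam.map hrs hr.le = t m := by
        intro m
        by_cases hm : m ∈ I
        · obtain ⟨r, s, h⟩ := D.fam.transitivity (t m₁) (t m) ((ht' _ hm₁).trans (ht' _ hm).symm)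
            (ht' _ hm₁ ▸ hl)
          exact ⟨r, s, fun _ => h⟩
        · exact ⟨t m, t m, fun h => absurd h hm⟩
      choose r s hrs using key
      -- As `I` is finite, a single `p < t m₁` serves all columns: each `t m` is the image of `t m₁`
      -- under the isomorphism from `p` to some `p' m`.
      have hsup : I.sup (fun m => ht (r m)) < α := by
        rw [Finset.sup_lt_iff (bot_lt_iff_ne_bot.2 hl.ne_bot)]
        intro m hm
        obtain ⟨hr, -⟩ := hrs m hm
        exact ht' _ hm₁ ▸ ht_lt_ht hr
      obtain ⟨p, hp, hpγ⟩ := exists_lt_ht_eq (t := t m₁) (by rw [ht' _ hm₁]; exact hsup)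
      have key : ∀ m, ∃ p', m ∈ I → ∃ h : ht p = ht p', D.fam.map h hp.le = t m := by
        intro m
        by_cases hm : m ∈ I
        · obtain ⟨hr, hs, h, heq⟩ := hrs m hm
          have hrp : r m ≤ p := by
            refine le_of_ht_le hr.le hp.le ?_
            rw [hpγ]
            exact Finset.le_sup (f := fun m => ht (r m)) hm
          refine ⟨D.fam.map h hrp, fun _ => ⟨(CoherentFamily.ht_map h hrp).symm, ?_⟩⟩
          refine CoherentFamily.map_eq_of_map_eq h _ hrp hp.le ?_ heq
          rw [← heq, CoherentFamily.map_le_map_iff]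
          exact hp.le
        · exact ⟨p, fun h => absurd h hm⟩
      choose p' hp' using key
      obtain ⟨q, hq⟩ := ih (ht p) (hpγ ▸ hsup) p' fun m hm => (hp' m hm).1.symm
      have hpq : ht p = ht q := (hp' _ hm₁).1.trans (D.eqv_ht _ _ _ (hq _ hm₁)).symm
      -- Moving `t m₁` from above `p` to above `q`, and then to above `p' m`, gives `t m`; the
      -- second move respects `≡_m` because `q ≡_m p' m`.
      refine ⟨D.fam.map hpq hp.le, fun m hm => ?_⟩
      obtain ⟨h, heq⟩ := hp' m hm
      have h1 := D.eqv_map (hq m hm) (hpq.symm.trans h) (CoherentFamily.le_map (F := D.fam) hpq hp.le)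
      rwa [CoherentFamily.map_map, heq] at h1

theorem proj_surjective (hT : IsSouslinTree T) (hn : 0 < n) (hIn : I.card ≤ n)
    (hI : I.Nonempty) : Function.Surjective (D.proj I) := by
  intro x
  choose f hf using fun m : I => Quotient.exists_rep (x.1 m)
  obtain ⟨m₁, hm₁⟩ := hI
  have hht : ∀ m : I, ht (f m) = ht (f ⟨m₁, hm₁⟩) := by
    intro m
    have := x.2 m ⟨m₁, hm₁⟩
    rwa [← hf, ← hf, TreeEquivalence.ht_mk, TreeEquivalence.ht_mk] at this
  obtain ⟨q, hq⟩ := D.exists_eqv_of_isSouslinTree hT hn hIn ⟨m₁, hm₁⟩ (ht (f ⟨m₁, hm₁⟩))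
    (fun m => if hm : m ∈ I then f ⟨m, hm⟩ else f ⟨m₁, hm₁⟩) (by
      intro m hm
      simp only [hm, dite_true]
      exact hht _)
  refine ⟨q, Subtype.ext (funext fun m => ?_)⟩
  rw [← hf m]
  have := hq m.1 m.2
  simp only [m.2, dite_true] at this
  exact Quotient.sound this

/-- For each `j`, some successor of `s` lies in the `j`-th piece in every column of `I`; different
`j` give different classes. -/
theorem infinite_covBy_proj [Nonempty I] (hn : 0 < n) (hIn : I.card ≤ n) (s : T) :
    {y | D.proj I s ⋖ y}.Infinite := by
  choose x hx using fun j : ℕ => D.optimal.exists_mem hn (I.image fun m => (D.h m s, m))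
    (Finset.card_image_le.trans hIn) fun _ => j
  refine Set.infinite_of_injective_forall_mem (f := fun j => D.proj I (D.succNode s (x j))) ?_ ?_
  · intro j k hjk
    obtain ⟨m, hm⟩ := ‹Nonempty I›
    have h1 := D.proj_eq_iff.1 hjk m hm
    rw [eqv_succNode_iff] at h1
    obtain ⟨-, i, hi, hi'⟩ := h1
    rw [D.eq_of_mem_piece (hx j _ (Finset.mem_image_of_mem _ hm)) hi,
      D.eq_of_mem_piece (hx k _ (Finset.mem_image_of_mem _ hm)) hi']
  · intro j
    have hc := covBy_iff_ht.1 (D.covBy_succNode s (x j))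
    refine covBy_iff_ht.2 ⟨lt_of_le_of_ne (D.proj_mono hc.1.le) fun h => ?_, ?_⟩
    · have := congrArg ht h
      rw [ht_proj, ht_proj] at this
      exact (ht_lt_ht hc.1).ne this
    · rw [ht_proj, ht_proj, hc.2]

theorem eq_of_Iio_eq [Nonempty I] {s t : T} (hl : Order.IsSuccLimit (ht s))
    (h : Set.Iio (D.proj I s) = Set.Iio (D.proj I t)) : D.proj I s = D.proj I t := by
  have hst : ht s = ht t := by
    have : ht (D.proj I s) = ht (D.proj I t) :=
      Ordinal.type_eq.2 ⟨(OrderIso.setCongr _ _ h).toRelIsoLT⟩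
    rwa [ht_proj, ht_proj] at this
  have hlt : ∀ {q s : T}, q < s → D.proj I q < D.proj I s := by
    intro q s hqs
    refine lt_of_le_of_ne (D.proj_mono hqs.le) fun h => (ht_lt_ht hqs).ne ?_
    rw [← D.ht_proj (I := I), h, ht_proj]
  rw [proj_eq_iff]
  intro m hm
  rw [D.eqv_limit m s t hst hl]
  intro q r hq hr hqr
  have h1 : D.proj I q < D.proj I t := by
    have : D.proj I q ∈ Set.Iio (D.proj I s) := hlt hq
    rwa [h] at this
  exact D.proj_eq_iff.1 (eq_of_ht_eq h1.le (hlt hr).le (by rw [ht_proj, ht_proj, hqr])) m hm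

theorem isSouslinTree_treeProd (hT : IsSouslinTree T) (hn : 0 < n) (hIn : I.card ≤ n)
    (hI : I.Nonempty) : IsSouslinTree (TreeProd fun m : I => D.Factor m) := by
  have := hI.to_subtype
  have hsurj := D.proj_surjective hT hn hIn hI
  refine hT.of_surjective (D.proj I) hsurj D.proj_mono D.ht_proj ?_ ?_
  · intro x
    obtain ⟨s, rfl⟩ := hsurj x
    exact D.infinite_covBy_proj hn hIn s
  · intro x y hx _ h
    obtain ⟨s, rfl⟩ := hsurj x
    obtain ⟨t, rfl⟩ := hsurj y
    rw [ht_proj] at hx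
    exact D.eq_of_Iio_eq hx h

/-! ### Automorphisms and rigidity -/

/-- Every automorphism of the product is locally induced by the coherent family. -/
theorem exists_orderIso_eq_map (hT : IsSouslinTree T) (hn : 0 < n) (hIn : I.card ≤ n)
    [Nonempty I] (φ : (TreeProd fun m : I => D.Factor m) ≃o TreeProd fun m : I => D.Factor m)
    (s₀ : T) : ∃ r, s₀ ≤ r ∧ ∃ (s : T) (h : ht r = ht s), ∀ (x : T) (hx : r ≤ x),
      φ (D.proj I x) = D.proj I (D.fam.map h hx) := by
  have hI : I.Nonempty := Finset.nonempty_coe_sort.1 ‹_›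
  have hsurj := D.proj_surjective hT hn hIn hI
  have hφ : ∀ t : T, ht (φ (D.proj I t)) = ht t := fun t => by rw [ht_orderIso, ht_proj]
  choose g hg using fun t => hsurj (φ (D.proj I t))
  have hgt : ∀ t, ht t = ht (g t) := fun t => by rw [← hφ t, ← hg t, ht_proj]
  by_contra! hcon
  let U : T → Set T := fun r =>
    {x | ∃ hx : r ≤ x, φ (D.proj I x) ≠ D.proj I (D.fam.map (hgt r) hx)}
  have hU : ∀ r, IsUpperSet (U r) := by
    rintro r x y hxy ⟨hx, hne⟩
    refine ⟨hx.trans hxy, fun h => hne ?_⟩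
    refine eq_of_ht_eq (t := φ (D.proj I y)) (φ.le_iff_le.2 (D.proj_mono hxy)) ?_ ?_
    · rw [h]
      exact D.proj_mono ((CoherentFamily.map_le_map_iff _ _ _).2 hxy)
    · rw [hφ, ht_proj, CoherentFamily.ht_map]
  -- Otherwise the isomorphism from `r` to `g r`, restricted to the nodes above `t`, is by coherence
  -- a member of the family that induces `φ` there.
  have hdense : ∀ r, s₀ ≤ r → ∀ t, r ≤ t → ∃ x, t ≤ x ∧ x ∈ U r := by
    intro r hr t hrt
    by_contra! h
    obtain ⟨x, hx, hne⟩ := hcon t (hr.trans hrt) (D.fam.map (hgt r) hrt)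
      (CoherentFamily.ht_map _ _).symm
    refine h x hx ⟨hrt.trans hx, ?_⟩
    rwa [CoherentFamily.map_coherent (hgt r) hrt _ rfl hx] at hne
  have hβ : ∀ r, ∃ β < Ordinal.omega.{u} 1, s₀ ≤ r → ∀ x, r ≤ x → β ≤ ht x → x ∈ U r := by
    intro r
    by_cases hr : s₀ ≤ r
    · obtain ⟨β, hβ, h⟩ := hT.exists_level_subset r (U r) (hU r) (hdense r hr)
      exact ⟨β, hβ, fun _ => h⟩
    · exact ⟨ht r, hT.ht_lt r, fun h => absurd h hr⟩
  choose β hβ hβU using hβ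
  obtain ⟨δ, hδ, hl, hlt, hcl⟩ := hT.exists_closed_limit β hβ (ht s₀) (hT.ht_lt s₀)
  obtain ⟨t, hst, rfl⟩ := hT.exists_gt s₀ hδ hlt
  obtain ⟨p, q, hp, hq, hpq, heq⟩ := D.fam.transitivity t (g t) (hgt t) hl
  change D.fam.map hpq hp.le = g t at heq
  -- The higher of `p` and `s₀`. Since `ht t` is closed under `β`, the node `t` belongs to `U r`.
  obtain ⟨r, hr, hs₀r, hpr⟩ : ∃ r, r < t ∧ s₀ ≤ r ∧ p ≤ r := by
    rcases le_total (ht p) (ht s₀) with h | h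
    · exact ⟨s₀, hst, le_rfl, le_of_ht_le hp.le hst.le h⟩
    · exact ⟨p, hp, le_of_ht_le hst.le hp.le h, le_rfl⟩
  obtain ⟨hrt, hne⟩ := hβU r hs₀r t hr.le (hcl r (ht_lt_ht hr)).le
  refine hne ?_
  set s := D.fam.map hpq hpr with hs
  have hrs : ht r = ht s := (CoherentFamily.ht_map hpq hpr).symm
  have hsg : s ≤ g t := by
    rw [← heq, hs, CoherentFamily.map_le_map_iff]
    exact hrt
  have hmap : D.fam.map hrs hrt = g t :=
    CoherentFamily.map_eq_of_map_eq hpq hrs hpr hrt hsg heq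
  -- The node `s` below `g t` need not be `g r`, but both project to the predecessor of `φ (D.proj I
  -- t)` on that level. By `eqv_map`, replacing `s` by `g r` does not change the projected image of
  -- `t`.
  have hsgr : D.proj I s = D.proj I (g r) := by
    refine eq_of_ht_eq (t := D.proj I (g t)) (D.proj_mono hsg) ?_ ?_
    · rw [hg, hg, φ.le_iff_le]
      exact D.proj_mono hrt
    · rw [ht_proj, ht_proj, ← hrs, hgt]
  have hsg' : ht s = ht (g r) := hrs.symm.trans (hgt r)
  have h1 : D.fam.map (hgt r) hrt = D.fam.map hsg' hsg := by
    rw [← CoherentFamily.map_map hrs hsg']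
    congr 1
  rw [h1, ← hg t, proj_eq_iff]
  exact fun m hm => D.eqv_map (D.proj_eq_iff.1 hsgr m hm) hsg' hsg

/-- If the isomorphism between `T(r)` and `T(s)` respects the equivalence of immediate successors,
then `r` and `s` are equivalent. -/
theorem proj_eq_of_map (hn : 0 < n) (hIn : I.card < n) {r s : T} (h : ht r = ht s)
    (hmap : ∀ x y, D.proj I (D.succNode r x) = D.proj I (D.succNode r y) →
      D.proj I (D.succNode s x) = D.proj I (D.succNode s y)) :
    D.proj I r = D.proj I s := by
  rw [proj_eq_iff]
  intro m₀ hm₀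
  rw [← D.h_eq_iff m₀ r s h]
  by_contra hne
  -- Here `|I| < n` is needed: besides the rows of `r`, the row of `s` in column `m₀` is prescribed.
  -- Index `0` in the rows of `r` makes the chosen successors of `r` equivalent, while the free
  -- index `i` separates those of `s`.
  have hcard : (insert (D.h m₀ s, m₀) (I.image fun m => (D.h m r, m))).card ≤ n :=
    (Finset.card_insert_le _ _).trans
      ((Nat.succ_le_succ Finset.card_image_le).trans (Nat.succ_le_of_lt hIn))
  choose x hx using fun i : ℕ => D.optimal.exists_mem hn _ hcard
    fun p => if p = (D.h m₀ s, m₀) then i else 0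
  have hxr : ∀ i, ∀ m ∈ I, x i ∈ D.a (D.h m r) m 0 := by
    intro i m hm
    have h1 := hx i (D.h m r, m)
      (Finset.mem_insert_of_mem (Finset.mem_image_of_mem (fun m => (D.h m r, m)) hm))
    have h2 : (D.h m r, m) ≠ (D.h m₀ s, m₀) := by
      intro heq
      obtain rfl : m = m₀ := congrArg Prod.snd heq
      exact hne (congrArg Prod.fst heq)
    rwa [if_neg h2] at h1
  have hxs : ∀ i, x i ∈ D.a (D.h m₀ s) m₀ i := by
    intro i
    have h1 := hx i (D.h m₀ s, m₀) (Finset.mem_insert_self _ _)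
    rwa [if_pos rfl] at h1
  have h1 := hmap (x 0) (x 1) (D.proj_eq_iff.2 fun m hm =>
    (D.eqv_succNode_iff m _ _ _ _).2 ⟨(D.eqv m).refl r, 0, hxr 0 m hm, hxr 1 m hm⟩)
  obtain ⟨-, i, h0, h1⟩ := (D.eqv_succNode_iff _ _ _ _ _).1 (D.proj_eq_iff.1 h1 m₀ hm₀)
  exact absurd ((D.eq_of_mem_piece (hxs 0) h0).trans (D.eq_of_mem_piece (hxs 1) h1).symm)
    zero_ne_one

theorem isRigid_treeProd (hT : IsSouslinTree T) (hIn : I.card < n)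
    (hI : I.Nonempty) : IsRigid (TreeProd fun m : I => D.Factor m) := by
  have := hI.to_subtype
  have hn : 0 < n := (Nat.zero_le _).trans_lt hIn
  intro φ
  refine DFunLike.ext _ _ fun y => ?_
  obtain ⟨t, rfl⟩ := D.proj_surjective hT hn hIn.le hI y
  obtain ⟨r, htr, s, h, hφ⟩ := D.exists_orderIso_eq_map hT hn hIn.le φ t
  have hrs : D.proj I r = D.proj I s := by
    refine D.proj_eq_of_map hn hIn h fun x y hxy => ?_
    have := congrArg φ hxy
    rwa [hφ _ (D.covBy_succNode r x).le, hφ _ (D.covBy_succNode r y).le, D.map_succNode,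
      D.map_succNode] at this
  have hr : φ (D.proj I r) = D.proj I r := by
    rw [hφ r le_rfl, CoherentFamily.map_self, hrs]
  -- A height preserving automorphism that fixes a node fixes all its predecessors.
  refine eq_of_ht_eq (t := D.proj I r) ?_ (D.proj_mono htr) (ht_orderIso φ _)
  rw [← hr, φ.le_iff_le]
  exact D.proj_mono htr

end Decomposition

end Souslin

theorem mainTheorem3 {T : Type u} [PartialOrder T] [Souslin.IsTree T]
    (hT : Souslin.IsSouslinTree T) (hT' : Souslin.IsStronglyHomogeneous T)
    (n : ℕ) (hn : 1 < n) (D : Souslin.Decomposition T n)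
    (I : Finset (Fin n)) (hI : I.Nonempty) (hIn : I.card < n) :
    Souslin.IsSouslinTree (Souslin.TreeProd fun m : I => D.Factor m) ∧
      Souslin.IsRigid (Souslin.TreeProd fun m : I => D.Factor m) :=
  ⟨D.isSouslinTree_treeProd hT (Nat.zero_lt_of_lt hn) hIn.le hI, D.isRigid_treeProd hT hIn hI⟩
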